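/- Let $\mathcal{M}$ be a (finite-dimensional, smooth) Riemannian manifold with a retraction $\mathrm{R}$, that is, a smooth map $\mathrm{R}\colon \mathrm{T}\mathcal{M}\to\mathcal{M}$, $(x,s)\mapsto \mathrm{R}_x(s)$, such that $\mathrm{R}_x(0)=x$ and the differential $\mathrm{D}\mathrm{R}_x(0)$ is the identity of $\mathrm{T}_x\mathcal{M}$ for every $x$. Let $f\colon\mathcal{M}\to\mathbb{R}$ be twice continuously differentiable and $x\in\mathcal{M}$. Then the pullback $\hat f=f\circ\mathrm{R}_x\colon \mathrm{T}_x\mathcal{M}\to\mathbb{R}$ is twice differentiable on the Euclidean space $\mathrm{T}_x\mathcal{M}$, and at every $s\in\mathrm{T}_x\mathcal{M}$ its gradient and Hessian are $$\nabla\hat f(s)=T_s^*\,\mathrm{grad} f(\mathrm{R}_x(s)),\qquad \nabla^2\hat f(s)=T_s^*\circ\mathrm{Hess} f(\mathrm{R}_x(s))\circ T_s+W_s.$$ Here $T_s=\mathrm{D}\mathrm{R}_x(s)\colon\mathrm{T}_x\mathcal{M}\to\mathrm{T}_{\mathrm{R}_x(s)}\mathcal{M}$, with adjoint $T_s^*$;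 $\mathrm{grad} f$ is the Riemannian gradient and $\mathrm{Hess} f=\nabla\,\mathrm{grad} f$ is the Riemannian Hessian (for the Levi-Civita connection); and $W_s$ is the symmetric linear operator on $\mathrm{T}_x\mathcal{M}$, which exists and is unique, such that for all $\dot s\in\mathrm{T}_x\mathcal{M}$ $$\langle W_s[\dot s],\dot s\rangle=\langle \mathrm{grad} f(\mathrm{R}_x(s)),c''(0)\rangle,$$ where $c''(0)$ is the intrinsic acceleration (the covariant derivative of the velocity field $c'$ along $c$) at $t=0$ of the curve $c(t)=\mathrm{R}_x(s+t\dot s)$ on $\mathcal{M}$. -/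

import Mathlib

open Bundle
open scoped Manifold ContDiff

noncomputable section

namespace RiemannianPullback

lemma mdifferentiableAt_inner_section
    {E : Type*} [NormedAddCommGroup E] [NormedSpace ℝ E]
    {H : Type*} [TopologicalSpace H] {I : ModelWithCorners ℝ E H}
    {M : Type*} [TopologicalSpace M] [ChartedSpace H M]
    {F : Type*} [NormedAddCommGroup F] [NormedSpace ℝ F]
    {V : M → Type*} [TopologicalSpace (TotalSpace F V)] [∀ x, NormedAddCommGroup (V x)]
    [∀ x, InnerProductSpace ℝ (V x)] [FiberBundle F V] [VectorBundle ℝ F V]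
    [IsContMDiffRiemannianBundle I 1 F V] {σ τ : Π x : M, V x} {x : M}
    (hσ : MDifferentiableAt I (I.prod 𝓘(ℝ, F)) (fun y ↦ (⟨y, σ y⟩ : TotalSpace F V)) x)
    (hτ : MDifferentiableAt I (I.prod 𝓘(ℝ, F)) (fun y ↦ (⟨y, τ y⟩ : TotalSpace F V)) x) :
    MDifferentiableAt I 𝓘(ℝ, ℝ) (fun y ↦ inner ℝ (σ y) (τ y)) x :=
  hσ.inner_bundle hτ

section Metric

set_option linter.unusedSectionVars false

variable {E : Type*} [NormedAddCommGroup E] [NormedSpace ℝ E] [FiniteDimensional ℝ E]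
  {H : Type*} [TopologicalSpace H] {I : ModelWithCorners ℝ E H}
  {M : Type*} [TopologicalSpace M] [ChartedSpace H M]

instance instFiniteDimensionalTangentSpace (x : M) : FiniteDimensional ℝ (TangentSpace I x) :=
  inferInstanceAs (FiniteDimensional ℝ E)

variable [IsManifold I ∞ M] [RiemannianBundle (fun x : M ↦ TangentSpace I x)]

instance instCompleteSpaceTangentSpace (x : M) : CompleteSpace (TangentSpace I x) :=
  FiniteDimensional.complete ℝ (TangentSpace I x)

/-! ### The Levi-Civita connection -/

/-- The local vector field with value `v` at `x` whose components in the preferred chart at `x` are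
constant (extended by zero outside the domain of that chart). -/
def constField {x : M} (v : TangentSpace I x) (y : M) : TangentSpace I y :=
  (trivializationAt E (TangentSpace I) x).symmL ℝ y
    ((trivializationAt E (TangentSpace I) x).continuousLinearMapAt ℝ x v)

lemma constField_eventuallyEq {x : M} (v : TangentSpace I x) :
    ∀ᶠ y in nhds x, constField v y = FiberBundle.extend E v y := by
  filter_upwards [(trivializationAt E (TangentSpace I) x).open_baseSet.mem_nhds
    (FiberBundle.mem_baseSet_trivializationAt' x)] with y hy
  rw [constField, Trivialization.continuousLinearMapAt_apply_of_mem (R := ℝ) _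
    (FiberBundle.mem_baseSet_trivializationAt' x), Trivialization.symmL_apply _ hy]
  rfl

lemma constField_add {x : M} (v w : TangentSpace I x) (y : M) :
    constField (v + w) y = constField v y + constField w y := by
  simp only [constField, map_add]

lemma constField_smul {x : M} (a : ℝ) (v : TangentSpace I x) (y : M) :
    constField (a • v) y = a • constField v y := by
  simp only [constField, map_smul]

@[simp]
lemma constField_self {x : M} (v : TangentSpace I x) : constField v x = v :=
  Trivialization.symmL_continuousLinearMapAt _ (FiberBundle.mem_baseSet_trivializationAt' x) _

lemma mdifferentiableAt_constField {x : M} (v : TangentSpace I x) :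
    MDifferentiableAt I I.tangent (fun y ↦ (⟨y, constField v y⟩ : TangentBundle I M)) x := by
  refine (FiberBundle.mdifferentiableAt_extend I E v).congr_of_eventuallyEq ?_
  filter_upwards [constField_eventuallyEq v] with y hy
  rw [hy]

/-- The differential at `x` of the function `⟨V, W⟩`, where `V`, `W` are the local vector fields
with values `v`, `w` at `x` that have constant components in the preferred chart at `x`.
In coordinates: `u ↦ ∑ uᵏ vⁱ wʲ ∂ₖ gᵢⱼ(x)`. -/
def metricDeriv (x : M) (v w : TangentSpace I x) : TangentSpace I x →L[ℝ] ℝ :=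
  mvfderiv I (fun y : M ↦ inner ℝ (constField v y) (constField w y)) x

variable [IsContMDiffRiemannianBundle I ∞ E (fun x : M ↦ TangentSpace I x)]

lemma metricDeriv_comm (x : M) (v w : TangentSpace I x) :
    metricDeriv x v w = metricDeriv x w v := by
  simp only [metricDeriv, real_inner_comm]

lemma mdifferentiableAt_inner_constField {x : M} (v w : TangentSpace I x) :
    MDifferentiableAt I 𝓘(ℝ, ℝ)
      (fun y : M ↦ inner ℝ (constField v y) (constField w y)) x :=
  mdifferentiableAt_inner_section (V := fun y : M ↦ TangentSpace I y)
    (mdifferentiableAt_constField v) (mdifferentiableAt_constField w)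

lemma metricDeriv_add_left (x : M) (v v' w : TangentSpace I x) :
    metricDeriv x (v + v') w = metricDeriv x v w + metricDeriv x v' w := by
  simp only [metricDeriv, constField_add, inner_add_left]
  exact mvfderiv_fun_add (mdifferentiableAt_inner_constField v w) (mdifferentiableAt_inner_constField v' w)

lemma metricDeriv_smul_left (x : M) (a : ℝ) (v w : TangentSpace I x) :
    metricDeriv x (a • v) w = a • metricDeriv x v w := by
  simp only [metricDeriv, constField_smul, inner_smul_left, conj_trivial]
  ext u
  have := mvfderiv_fun_mul (I := I) (f := fun _ : M ↦ a) mdifferentiableAt_const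
    (mdifferentiableAt_inner_constField v w)
  rw [this, mvfderiv_const]
  simp

lemma metricDeriv_add_right (x : M) (v w w' : TangentSpace I x) :
    metricDeriv x v (w + w') = metricDeriv x v w + metricDeriv x v w' := by
  simp only [metricDeriv_comm x v, metricDeriv_add_left]

lemma metricDeriv_smul_right (x : M) (a : ℝ) (v w : TangentSpace I x) :
    metricDeriv x v (a • w) = a • metricDeriv x v w := by
  simp only [metricDeriv_comm x v, metricDeriv_smul_left]

/-- The Christoffel symbols of the first kind at `x` in the preferred chart at `x`:
`w ↦ ½ (Dᵤ⟨V, W⟩ + D_v⟨U, W⟩ - D_w⟨U, V⟩)` for vector fields `U`, `V`, `W` with constant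
components in that chart. -/
def christoffelForm (x : M) (v u : TangentSpace I x) : TangentSpace I x →L[ℝ] ℝ :=
  LinearMap.toContinuousLinearMap
    { toFun := fun w ↦
        (1 / 2 : ℝ) * (metricDeriv x v w u + metricDeriv x u w v - metricDeriv x u v w)
      map_add' := fun w w' ↦ by
        simp only [metricDeriv_add_right, add_apply, map_add]; ring
      map_smul' := fun a w ↦ by
        simp only [metricDeriv_smul_right, smul_apply, map_smul, smul_eq_mul,
          RingHom.id_apply]
        ring }

lemma christoffelForm_apply (x : M) (v u w : TangentSpace I x) :
    christoffelForm x v u w =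
      (1 / 2 : ℝ) * (metricDeriv x v w u + metricDeriv x u w v - metricDeriv x u v w) := rfl

/-- The Christoffel symbols (of the second kind) at `x` in the preferred chart at `x`:
`christoffel x v u = ∑ Γᵏᵢⱼ(x) uⁱ vʲ ∂ₖ`. -/
def christoffel (x : M) (v : TangentSpace I x) : TangentSpace I x →L[ℝ] TangentSpace I x :=
  LinearMap.toContinuousLinearMap
    { toFun := fun u ↦ (InnerProductSpace.toDual ℝ (TangentSpace I x)).symm (christoffelForm x v u)
      map_add' := fun u u' ↦ by
        rw [← map_add]
        congr 1
        ext w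
        simp only [christoffelForm_apply, metricDeriv_add_left, add_apply,
          map_add]
        ring
      map_smul' := fun a u ↦ by
        apply ext_inner_right ℝ
        intro w
        simp only [RingHom.id_apply, inner_smul_left, InnerProductSpace.toDual_symm_apply,
          christoffelForm_apply, metricDeriv_smul_left, smul_apply, map_smul,
          smul_eq_mul, conj_trivial]
        ring }

lemma inner_christoffel (x : M) (v u w : TangentSpace I x) :
    inner ℝ (christoffel x v u) w =
      (1 / 2 : ℝ) * (metricDeriv x v w u + metricDeriv x u w v - metricDeriv x u v w) :=
  InnerProductSpace.toDual_symm_apply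

lemma christoffel_add (x : M) (v v' : TangentSpace I x) :
    christoffel x (v + v') = christoffel x v + christoffel x v' := by
  ext u
  apply ext_inner_right ℝ
  intro w
  simp only [add_apply, inner_add_left, inner_christoffel, metricDeriv_add_left,
    metricDeriv_add_right, map_add]
  ring

lemma christoffel_smul (x : M) (a : ℝ) (v : TangentSpace I x) :
    christoffel x (a • v) = a • christoffel x v := by
  ext u
  apply ext_inner_right ℝ
  intro w
  simp only [smul_apply, inner_smul_left, inner_christoffel, metricDeriv_smul_left,
    metricDeriv_smul_right, map_smul, smul_eq_mul, conj_trivial]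
  ring

/-- The components, in the trivialization given by the preferred chart at `x`, of a vector
field. -/
def localRep (x : M) (σ : Π y : M, TangentSpace I y) (y : M) : E :=
  (trivializationAt E (TangentSpace I) x).continuousLinearMapAt ℝ y (σ y)

lemma mdifferentiableAt_localRep {x : M} {σ : Π y : M, TangentSpace I y} 
    (hσ : MDifferentiableAt I I.tangent (fun y ↦ (⟨y, σ y⟩ : TangentBundle I M)) x) :
    MDifferentiableAt I 𝓘(ℝ, E) (localRep x σ) x := by
  refine ((mdifferentiableAt_section I σ).1 hσ).congr_of_eventuallyEq ?_
  filter_upwards [(trivializationAt E (TangentSpace I) x).open_baseSet.mem_nhds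
    (FiberBundle.mem_baseSet_trivializationAt' x)] with y hy
  exact Trivialization.continuousLinearMapAt_apply_of_mem (R := ℝ) _ hy _

lemma symmL_localRep_self (x : M) (σ : Π y : M, TangentSpace I y) :
    (trivializationAt E (TangentSpace I) x).symmL ℝ x (localRep x σ x) = σ x :=
  Trivialization.symmL_continuousLinearMapAt _ (FiberBundle.mem_baseSet_trivializationAt' x) _

/-- The Levi-Civita connection of a Riemannian manifold,
`∇_u σ (x) = ∑ (∂ᵤσᵏ + Γᵏᵢⱼ uⁱ σʲ) ∂ₖ` in the preferred chart at `x`. -/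
def leviCivita : CovariantDerivative I E (TangentSpace I : M → Type _) where
  toFun σ x :=
    (trivializationAt E (TangentSpace I) x).symmL ℝ x ∘L mvfderiv I (localRep x σ) x +
      christoffel x (σ x)
  isCovariantDerivativeOnUniv :=
    { add := fun {σ σ' x} hσ hσ' _ ↦ by
        have h : localRep x (σ + σ') = localRep x σ + localRep x σ' := by
          ext y; simp [localRep]
        rw [h, mvfderiv_add (mdifferentiableAt_localRep hσ) (mdifferentiableAt_localRep hσ')]
        rw [Pi.add_apply, christoffel_add]
        ext u
        simp only [ContinuousLinearMap.comp_add, add_apply]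
        abel
      leibniz := fun {σ g x} hσ hg _ ↦ by
        have h : localRep x (g • σ) = g • localRep x σ := by
          ext y; simp [localRep]
        rw [h, mvfderiv_smul hg (mdifferentiableAt_localRep hσ)]
        rw [Pi.smul_apply', christoffel_smul]
        ext u
        have hs := symmL_localRep_self x σ
        simp only [ContinuousLinearMap.comp_apply, add_apply, smul_apply,
          ContinuousLinearMap.smulRight_apply, map_add, map_smul, hs, smul_add]
        abel }

lemma christoffel_comm (x : M) (v u : TangentSpace I x) :
    christoffel x v u = christoffel x u v := by
  apply ext_inner_right ℝ
  intro w
  rw [inner_christoffel, inner_christoffel, metricDeriv_comm x u v]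
  ring

lemma leviCivita_constField {x : M} (v u : TangentSpace I x) :
    leviCivita (constField v) x u = christoffel x v u := by
  have h : localRep x (constField v) =ᶠ[nhds x]
      fun _ ↦ (trivializationAt E (TangentSpace I) x).continuousLinearMapAt ℝ x v := by
    filter_upwards [(trivializationAt E (TangentSpace I) x).open_baseSet.mem_nhds
      (FiberBundle.mem_baseSet_trivializationAt' x)] with y hy
    exact Trivialization.continuousLinearMapAt_symmL _ hy _
  have h0 : mvfderiv I (localRep x (constField v)) x = 0 := by
    have h1 := ((hasMFDerivAt_const (I := I) (I' := 𝓘(ℝ, E))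
      ((trivializationAt E (TangentSpace I) x).continuousLinearMapAt ℝ x v)
        x).congr_of_eventuallyEq h).mfderiv
    rw [mvfderiv, h1]
    exact ContinuousLinearMap.comp_zero _
  simp [leviCivita, h0]

/-- The connection `leviCivita` is compatible with the Riemannian metric. -/
theorem leviCivita_isMetricCompatible :
    CovariantDerivative.IsMetricCompatible (V := fun x : M ↦ TangentSpace I x) (I := I) (F := E)
      leviCivita := by
  rw [CovariantDerivative.IsMetricCompatible]
  ext x v w u
  have h := CovariantDerivative.derivMetricTensor_apply (V := fun x : M ↦ TangentSpace I x)
    (F := E) leviCivita (X := constField u) x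
    (mdifferentiableAt_constField v) (mdifferentiableAt_constField w)
  simp only [constField_self, leviCivita_constField] at h
  refine h.trans ?_
  rw [real_inner_comm (christoffel x w u) v, inner_christoffel, inner_christoffel,
    metricDeriv_comm x w v]
  change metricDeriv x v w u - _ - _ = 0
  ring

lemma mpullbackWithin_constField {x : M} (v : TangentSpace I x) :
    VectorField.mpullbackWithin 𝓘(ℝ, E) I (extChartAt I x).symm (constField v) (Set.range I)
      =ᶠ[nhdsWithin (extChartAt I x x) (Set.range I)]
        fun _ ↦ (trivializationAt E (TangentSpace I) x).continuousLinearMapAt ℝ x v := by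
  filter_upwards [extChartAt_target_mem_nhdsWithin x] with z hz
  have hy : (extChartAt I x).symm z ∈ (chartAt H x).source := by
    simpa using (extChartAt I x).map_target hz
  rw [VectorField.mpullbackWithin, constField, TangentBundle.symmL_trivializationAt hy,
    (extChartAt I x).right_inv hz]
  exact (isInvertible_mfderivWithin_extChartAt_symm hz).inverse_apply_eq.2 rfl

lemma mlieBracket_constField {x : M} (v w : TangentSpace I x) :
    VectorField.mlieBracket I (constField v) (constField w) x = 0 := by
  rw [VectorField.mlieBracket, VectorField.mlieBracketWithin_apply]
  have h := Filter.EventuallyEq.lieBracketWithin_vectorField_eq_of_mem (𝕜 := ℝ)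
    (mpullbackWithin_constField v) (mpullbackWithin_constField w)
    (Set.mem_range_self (f := I) (chartAt H x x))
  rw [Set.preimage_univ, Set.univ_inter]
  refine (congrArg _ (h.trans ?_)).trans (map_zero _)
  simp only [VectorField.lieBracketWithin, fderivWithin_fun_const, Pi.zero_apply,
    zero_apply, sub_self]
  rfl

/-- The connection `leviCivita` is torsion-free. -/
theorem leviCivita_torsion :
    (leviCivita : CovariantDerivative I E (TangentSpace I : M → Type _)).torsion = 0 := by
  ext x v w
  have h := CovariantDerivative.torsion_apply
    (leviCivita : CovariantDerivative I E (TangentSpace I : M → Type _))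
    (mdifferentiableAt_constField v) (mdifferentiableAt_constField w)
  simp only [constField_self, leviCivita_constField, mlieBracket_constField] at h
  rw [h, christoffel_comm]
  simp

/-! ### Covariant derivative along a curve -/

/-- The velocity `c'(t)` of a curve. -/
def velocity (c : ℝ → M) (t : ℝ) : TangentSpace I (c t) :=
  mfderiv 𝓘(ℝ, ℝ) I c t (1 : ℝ)

/-- The covariant derivative `D/dt`, induced by the Levi-Civita connection, of a vector field `V`
along a curve `c`. Writing `V(τ) = ∑ Vᵏ(τ) ∂ₖ` in the preferred chart at `c(t)`, it is
`∑ (Vᵏ)'(t) ∂ₖ + ∑ Vᵏ(t) ∇_{c'(t)} ∂ₖ`; in the last sum `∑ Vᵏ(t) ∂ₖ` is `constField (V t)`. -/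
def covariantDerivAlong (c : ℝ → M) (V : Π t : ℝ, TangentSpace I (c t)) (t : ℝ) :
    TangentSpace I (c t) :=
  (trivializationAt E (TangentSpace I) (c t)).symmL ℝ (c t)
      (deriv (fun τ : ℝ ↦
        (trivializationAt E (TangentSpace I) (c t)).continuousLinearMapAt ℝ (c τ) (V τ)) t) +
    leviCivita (constField (V t)) (c t) (velocity c t)

/-- Along a curve, `D/dt` of the restriction of a vector field `σ` on `M` is `∇_{c'} σ`. -/
theorem covariantDerivAlong_comp {c : ℝ → M} {t : ℝ} (σ : Π y : M, TangentSpace I y)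
    (hc : MDifferentiableAt 𝓘(ℝ, ℝ) I c t)
    (hσ : MDifferentiableAt I I.tangent (fun y ↦ (⟨y, σ y⟩ : TangentBundle I M)) (c t)) :
    covariantDerivAlong c (fun τ ↦ σ (c τ)) t = leviCivita σ (c t) (velocity c t) := by
  have h := (mdifferentiableAt_localRep hσ).hasMFDerivAt.comp t hc.hasMFDerivAt
  let L : ℝ →L[ℝ] E := mvfderiv I (localRep (c t) σ) (c t) ∘L mfderiv 𝓘(ℝ, ℝ) I c t
  have h' : HasFDerivAt (localRep (c t) σ ∘ c) L t := h.hasFDerivAt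
  rw [covariantDerivAlong, leviCivita_constField]
  exact congrArg (fun e : E ↦ (trivializationAt E (TangentSpace I) (c t)).symmL ℝ (c t) e +
    christoffel (c t) (σ (c t)) (velocity c t)) h'.hasDerivAt.deriv

/-- The intrinsic acceleration `c''(t)`: the covariant derivative of the velocity field. -/
def acceleration (c : ℝ → M) (t : ℝ) : TangentSpace I (c t) :=
  covariantDerivAlong c (velocity c) t

/-! ### Riemannian gradient and Hessian -/

variable (I) in
/-- The Riemannian gradient: `⟨grad f (x), v⟩ = D f(x)[v]`. -/
def grad (f : M → ℝ) (x : M) : TangentSpace I x :=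
  (InnerProductSpace.toDual ℝ (TangentSpace I x)).symm (mvfderiv I f x)

variable (I) in
/-- The Riemannian Hessian: `Hess f (x)[v] = ∇_v grad f`. -/
def hess (f : M → ℝ) (x : M) : TangentSpace I x →L[ℝ] TangentSpace I x :=
  leviCivita (grad I f) x

/-! ### Retractions -/

variable (I M) in
/-- A retraction on `M`: a smooth map `R : TM → M` such that `Rₓ(0) = x` and `D Rₓ(0)` is the
identity of `TₓM` (stated as an equality of tangent vectors `D Rₓ(0)[v] = v` in `TM`). -/
structure Retraction where
  toFun : TangentBundle I M → M
  contMDiff_toFun : ContMDiff I.tangent I ∞ toFun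
  map_zero : ∀ x : M, toFun ⟨x, 0⟩ = x
  tangentMap_zero : ∀ (x : M) (v : TangentSpace I x),
    (⟨toFun ⟨x, 0⟩, mfderiv 𝓘(ℝ, TangentSpace I x) I
      (fun s : TangentSpace I x ↦ toFun ⟨x, s⟩) 0 v⟩ : TangentBundle I M) = ⟨x, v⟩

namespace Retraction

/-- `Rₓ : TₓM → M`. -/
def restrict (R : Retraction I M) (x : M) (s : TangentSpace I x) : M :=
  R.toFun ⟨x, s⟩

/-- `T_s = D Rₓ(s) : TₓM → T_{Rₓ(s)}M`. -/
def diff (R : Retraction I M) (x : M) (s : TangentSpace I x) :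
    TangentSpace I x →L[ℝ] TangentSpace I (R.restrict x s) :=
  mfderiv 𝓘(ℝ, TangentSpace I x) I (R.restrict x) s

/-- The pullback `f ∘ Rₓ : TₓM → ℝ`. -/
def pullback (R : Retraction I M) (f : M → ℝ) (x : M) : TangentSpace I x → ℝ :=
  f ∘ R.restrict x

/-- The curve `c(t) = Rₓ(s + t ṡ)`. -/
def curve (R : Retraction I M) (x : M) (s ds : TangentSpace I x) (t : ℝ) : M :=
  R.restrict x (s + t • ds)

end Retraction

end Metric
end RiemannianPullback
end

/-! The pullback is a `C²` function on the Euclidean space `TₓM`, so the derivative `A` of its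
gradient is symmetric, and by polarization `A` is determined by `⟨A v, v⟩`, the second derivative
along the line `s + t v`. The retraction maps this line to a curve `c` with `c'(0) = T_s v`, so
everything rests on the identity `(f ∘ c)'' = ⟨Hess f [c'], c'⟩ + ⟨grad f, c''⟩`
(`deriv_deriv_comp_curve`). Given this identity, `W = A - T_s* Hess f T_s` is symmetric and has the
required quadratic form (`exists_isSymmetric_add_conj`).

The curve identity is checked at one point, in the chart centred there. Metric compatibility gives
`Hess f` as the coordinate Hessian minus `⟨grad f, Γ⟩` (`inner_hess`), while `c''` is the coordinate
acceleration plus `Γ(c', c')` (`acceleration_eq`). The Christoffel terms cancel, which leaves the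
Euclidean second-order chain rule. Metric compatibility applies only to differentiable fields, hence
the need for `mdifferentiableAt_grad`. -/

namespace RiemannianPullback

/-! ### First and second derivatives of a function in a chart -/

section Chart

variable {E : Type*} [NormedAddCommGroup E] [NormedSpace ℝ E]
  {H : Type*} [TopologicalSpace H] {I : ModelWithCorners ℝ E H} [I.Boundaryless]
  {M : Type*} [TopologicalSpace M] [ChartedSpace H M] [IsManifold I ∞ M]

/-- On the chart domain `symmL` is the derivative of the inverse chart, so this is the chain rule.
Without boundary, the derivative within `range I` is the full one. -/
lemma mvfderiv_symmL {f : M → ℝ} {x y : M} (hy : y ∈ (chartAt H x).source)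
    (hf : MDifferentiableAt I 𝓘(ℝ, ℝ) f y) (e : E) :
    mvfderiv I f y ((trivializationAt E (TangentSpace I) x).symmL ℝ y e) =
      fderiv ℝ (f ∘ (extChartAt I x).symm) (extChartAt I x y) e := by
  have hy' : y ∈ (extChartAt I x).source := by simpa using hy
  have hs : MDifferentiableAt 𝓘(ℝ, E) I (extChartAt I x).symm (extChartAt I x y) := by
    have := mdifferentiableWithinAt_extChartAt_symm (I := I) ((extChartAt I x).map_source hy')
    rwa [I.range_eq_univ, mdifferentiableWithinAt_univ] at this
  rw [TangentBundle.symmL_trivializationAt hy, I.range_eq_univ, mfderivWithin_univ]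
  refine (mvfderiv_comp_apply_of_eq _ hf hs ((extChartAt I x).left_inv hy') e).symm.trans ?_
  rw [mvfderiv, mfderiv_eq_fderiv]
  rfl

lemma contDiffAt_comp_extChartAt_symm {n : ℕ∞} {f : M → ℝ} {x : M}
    (hf : ContMDiffAt I 𝓘(ℝ, ℝ) n f x) :
    ContDiffAt ℝ n (f ∘ (extChartAt I x).symm) (extChartAt I x x) := by
  have hs : ContMDiffAt 𝓘(ℝ, E) I n (extChartAt I x).symm (extChartAt I x x) :=
    ((contMDiffOn_extChartAt_symm (I := I) (n := ∞) x).contMDiffAt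
      (extChartAt_target_mem_nhds x)).of_le (by exact_mod_cast le_top)
  exact (ContMDiffAt.comp_of_eq hf hs (by simp)).contDiffAt

omit [I.Boundaryless] in
lemma hasMFDerivAt_extChartAt_self (x : M) :
    HasMFDerivAt I 𝓘(ℝ, E) (extChartAt I x) x
      ((trivializationAt E (TangentSpace I) x).continuousLinearMapAt ℝ x) := by
  rw [TangentBundle.continuousLinearMapAt_trivializationAt (mem_chart_source H x)]
  exact (mdifferentiableAt_extChartAt (mem_chart_source H x)).hasMFDerivAt

lemma eventually_mvfderiv_comp_symmL {f : M → ℝ} (hf : MDifferentiable I 𝓘(ℝ, ℝ) f) (x : M) :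
    ∀ᶠ y in nhds x, (mvfderiv I f y ∘L (trivializationAt E (TangentSpace I) x).symmL ℝ y) =
      fderiv ℝ (f ∘ (extChartAt I x).symm) (extChartAt I x y) := by
  filter_upwards [chart_source_mem_nhds H x] with y hy
  ext e
  exact mvfderiv_symmL hy (hf y) e

lemma differentiableAt_fderiv_comp_extChartAt_symm {f : M → ℝ} {x : M}
    (hf : ContMDiffAt I 𝓘(ℝ, ℝ) 2 f x) :
    DifferentiableAt ℝ (fderiv ℝ (f ∘ (extChartAt I x).symm)) (extChartAt I x x) :=
  ((contDiffAt_comp_extChartAt_symm (n := 2) hf).fderiv_right (m := 1)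
    (by norm_num)).differentiableAt one_ne_zero

/-- Second derivative at `x`, in the preferred chart at `x`, of a function on `M`. -/
noncomputable def chartHess (f : M → ℝ) (x : M) : E →L[ℝ] E →L[ℝ] ℝ :=
  fderiv ℝ (fderiv ℝ (f ∘ (extChartAt I x).symm)) (extChartAt I x x)

lemma chartHess_comm {f : M → ℝ} {x : M} (hf : ContMDiffAt I 𝓘(ℝ, ℝ) 2 f x) (u v : E) :
    chartHess (I := I) f x u v = chartHess (I := I) f x v u :=
  ((contDiffAt_comp_extChartAt_symm (n := 2) hf).isSymmSndFDerivAt (by simp)).eq u v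

lemma hasMFDerivAt_fderiv_extChartAt {f : M → ℝ} {x : M} (hf : ContMDiffAt I 𝓘(ℝ, ℝ) 2 f x) :
    HasMFDerivAt I 𝓘(ℝ, E →L[ℝ] ℝ)
      (fun y ↦ fderiv ℝ (f ∘ (extChartAt I x).symm) (extChartAt I x y)) x
      ((chartHess (I := I) f x) ∘L
        (trivializationAt E (TangentSpace I) x).continuousLinearMapAt ℝ x) :=
  (differentiableAt_fderiv_comp_extChartAt_symm hf).hasFDerivAt.hasMFDerivAt.comp x
    (hasMFDerivAt_extChartAt_self x)

/-- Near `x` the field has constant components, so only the coordinate differential of `f` varies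
and no first-order term appears. -/
lemma mvfderiv_mvfderiv_constField {f : M → ℝ} (hf : ContMDiff I 𝓘(ℝ, ℝ) 2 f) {x : M}
    (v u : TangentSpace I x) :
    mvfderiv I (fun y ↦ mvfderiv I f y (constField v y)) x u =
      chartHess (I := I) f x
        ((trivializationAt E (TangentSpace I) x).continuousLinearMapAt ℝ x u)
        ((trivializationAt E (TangentSpace I) x).continuousLinearMapAt ℝ x v) := by
  set e := (trivializationAt E (TangentSpace I) x).continuousLinearMapAt ℝ x v with he
  have h1 := ((ContinuousLinearMap.apply ℝ ℝ e).hasFDerivAt.hasMFDerivAt).comp x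
    (hasMFDerivAt_fderiv_extChartAt hf.contMDiffAt)
  have h2 := h1.congr_of_eventuallyEq (f₁ := fun y ↦ mvfderiv I f y (constField v y)) (by
    filter_upwards [eventually_mvfderiv_comp_symmL (hf.mdifferentiable two_ne_zero) x] with y hy
    exact congrArg (fun L : E →L[ℝ] ℝ ↦ L e) hy)
  exact congrArg (fun L : TangentSpace I x →L[ℝ] ℝ ↦ L u) h2.mfderiv

end Chart

end RiemannianPullback

namespace RiemannianPullback

/-! ### Differentiability of the gradient; the Hessian in coordinates -/

section Gradient

variable {E : Type*} [NormedAddCommGroup E] [NormedSpace ℝ E]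
  {H : Type*} [TopologicalSpace H] {I : ModelWithCorners ℝ E H}
  {M : Type*} [TopologicalSpace M] [ChartedSpace H M]

/-- In finite dimension `F` is the finite sum of the `F(bᵢ)` tensored with the dual basis, so
pointwise differentiability suffices. -/
lemma mdifferentiableAt_clm_of_apply [FiniteDimensional ℝ E]
    {G : Type*} [NormedAddCommGroup G] [NormedSpace ℝ G] {F : M → E →L[ℝ] G} {x : M}
    (h : ∀ e, MDifferentiableAt I 𝓘(ℝ, G) (fun y ↦ F y e) x) :
    MDifferentiableAt I 𝓘(ℝ, E →L[ℝ] G) F x := by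
  let b := Module.finBasis ℝ E
  let L (i) : G →L[ℝ] E →L[ℝ] G :=
    ContinuousLinearMap.smulRightL ℝ E G (LinearMap.toContinuousLinearMap (b.coord i))
  have hF : F = ∑ i, fun y ↦ L i (F y (b i)) := by
    ext y e
    simp only [Finset.sum_apply, sum_apply]
    conv_lhs => rw [← b.sum_repr e, map_sum]
    exact Finset.sum_congr rfl fun i _ ↦ by simp [L]
  rw [hF]
  exact .sum fun i _ ↦ (L i).differentiableAt.comp_mdifferentiableAt (h (b i))

variable [FiniteDimensional ℝ E] [IsManifold I ∞ M]
  [RiemannianBundle (fun x : M ↦ TangentSpace I x)]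

/-- The metric at `y` in the trivialization given by the preferred chart at `x`. -/
noncomputable def gramForm (x y : M) : E →L[ℝ] E →L[ℝ] ℝ :=
  (innerSL ℝ : TangentSpace I y →L[ℝ] TangentSpace I y →L[ℝ] ℝ).bilinearComp
    ((trivializationAt E (TangentSpace I) x).symmL ℝ y)
    ((trivializationAt E (TangentSpace I) x).symmL ℝ y)

omit [FiniteDimensional ℝ E] in
lemma gramForm_apply (x y : M) (e e' : E) :
    gramForm (I := I) x y e e' =
      inner ℝ ((trivializationAt E (TangentSpace I) x).symmL ℝ y e)
        ((trivializationAt E (TangentSpace I) x).symmL ℝ y e') := rfl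

omit [FiniteDimensional ℝ E] in
lemma injective_gramForm {x y : M} (hy : y ∈ (trivializationAt E (TangentSpace I) x).baseSet) :
    Function.Injective (gramForm (I := I) x y) := by
  refine (injective_iff_map_eq_zero _).2 fun e he ↦ ?_
  have h : (trivializationAt E (TangentSpace I) x).symmL ℝ y e = 0 := by
    rw [← inner_self_eq_zero (𝕜 := ℝ), ← gramForm_apply, he]
    rfl
  rw [← Trivialization.continuousLinearMapAt_symmL (R := ℝ) _ hy e, h, map_zero]

/-- Positive definiteness gives injectivity, and equality of dimensions upgrades it to an
isomorphism. -/
lemma exists_equiv_gramForm {x y : M}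
    (hy : y ∈ (trivializationAt E (TangentSpace I) x).baseSet) :
    ∃ L : E ≃L[ℝ] (E →L[ℝ] ℝ), (L : E →L[ℝ] E →L[ℝ] ℝ) = gramForm (I := I) x y := by
  have hd : Module.finrank ℝ E = Module.finrank ℝ (E →L[ℝ] ℝ) := by
    rw [← LinearMap.toContinuousLinearMap.finrank_eq, Module.finrank_linearMap_self]
  exact ⟨(LinearMap.linearEquivOfInjective (gramForm (I := I) x y).toLinearMap
    (injective_gramForm hy) hd).toContinuousLinearEquiv, by ext; rfl⟩

lemma mdifferentiableAt_gramForm [IsContMDiffRiemannianBundle I ∞ E (fun x : M ↦ TangentSpace I x)]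
    (x : M) : MDifferentiableAt I 𝓘(ℝ, E →L[ℝ] E →L[ℝ] ℝ) (gramForm (I := I) x) x := by
  refine mdifferentiableAt_clm_of_apply fun e ↦ mdifferentiableAt_clm_of_apply fun e' ↦ ?_
  -- These tangent vectors are chosen so that their constant components are exactly `e` and `e'`.
  have h := mdifferentiableAt_inner_constField (I := I)
    ((trivializationAt E (TangentSpace I) x).symmL ℝ x e)
    ((trivializationAt E (TangentSpace I) x).symmL ℝ x e')
  simp only [constField, Trivialization.continuousLinearMapAt_symmL (R := ℝ) _
    (FiberBundle.mem_baseSet_trivializationAt' x)] at h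
  exact h

omit [IsManifold I ∞ M] in
lemma inner_grad (f : M → ℝ) (x : M) (v : TangentSpace I x) :
    inner ℝ (grad I f x) v = mvfderiv I f x v :=
  InnerProductSpace.toDual_symm_apply

lemma gramForm_localRep_grad (f : M → ℝ) {x y : M}
    (hy : y ∈ (trivializationAt E (TangentSpace I) x).baseSet) :
    gramForm (I := I) x y (localRep x (grad I f) y) =
      mvfderiv I f y ∘L (trivializationAt E (TangentSpace I) x).symmL ℝ y := by
  ext e
  rw [gramForm_apply, localRep, Trivialization.symmL_continuousLinearMapAt _ hy, inner_grad]
  rfl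

variable [I.Boundaryless] [IsContMDiffRiemannianBundle I ∞ E (fun x : M ↦ TangentSpace I x)]

set_option synthInstance.maxHeartbeats 200000 in
/-- The Riemannian gradient of a `C²` function is a differentiable vector field. -/
lemma mdifferentiableAt_grad {f : M → ℝ} (hf : ContMDiff I 𝓘(ℝ, ℝ) 2 f) (x : M) :
    MDifferentiableAt I I.tangent (fun y ↦ (⟨y, grad I f y⟩ : TangentBundle I M)) x := by
  have hx := FiberBundle.mem_baseSet_trivializationAt' (F := E) (E := TangentSpace I) x
  obtain ⟨L, hL⟩ := exists_equiv_gramForm (I := I) hx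
  have hinv : DifferentiableAt ℝ ContinuousLinearMap.inverse (gramForm (I := I) x x) := by
    rw [← hL]
    exact (contDiffAt_map_inverse (n := 1) L).differentiableAt one_ne_zero
  -- In coordinates `grad f = G⁻¹ df`, with `G` the Gram form and inversion differentiable at the
  -- invertible `G(x)`.
  have h := (hinv.comp_mdifferentiableAt (mdifferentiableAt_gramForm x)).clm_apply
    (hasMFDerivAt_fderiv_extChartAt (I := I) hf.contMDiffAt).mdifferentiableAt
  refine (mdifferentiableAt_section I _).2 (h.congr_of_eventuallyEq ?_)
  filter_upwards [(trivializationAt E (TangentSpace I) x).open_baseSet.mem_nhds hx,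
    eventually_mvfderiv_comp_symmL (hf.mdifferentiable two_ne_zero) x] with y hy hfy
  -- `G(y)` is invertible on the whole base set, so the total function `inverse` is a true inverse
  -- here.
  obtain ⟨L, hL⟩ := exists_equiv_gramForm (I := I) hy
  rw [← hfy, ← gramForm_localRep_grad f hy, Function.comp_apply, ← hL,
    ContinuousLinearMap.inverse_equiv]
  refine Eq.trans ?_ (L.symm_apply_apply _).symm
  exact (Trivialization.continuousLinearMapAt_apply_of_mem (R := ℝ) _ hy _).symm

/-- Differentiate `⟨grad f, V⟩ = Df[V]` along `u`, for `V` the field with constant components and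
value `v`, using metric compatibility and `∇_u V = Γ(v, u)`. -/
lemma inner_hess {f : M → ℝ} (hf : ContMDiff I 𝓘(ℝ, ℝ) 2 f) {x : M} (u v : TangentSpace I x) :
    inner ℝ (hess I f x u) v =
      chartHess (I := I) f x
        ((trivializationAt E (TangentSpace I) x).continuousLinearMapAt ℝ x u)
        ((trivializationAt E (TangentSpace I) x).continuousLinearMapAt ℝ x v) -
      inner ℝ (grad I f x) (christoffel x v u) := by
  have h := CovariantDerivative.IsMetricCompatible.mvfderiv_inner_eq
    (leviCivita_isMetricCompatible (I := I) (M := M)) (constField u)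
    (mdifferentiableAt_grad hf x) (mdifferentiableAt_constField v)
  simp only [constField_self, leviCivita_constField] at h
  rw [eq_sub_iff_add_eq, ← mvfderiv_mvfderiv_constField hf]
  refine h.symm.trans ?_
  congr 2
  ext y
  exact inner_grad f y _

/-- Both terms of `inner_hess` are symmetric: mixed partials commute, and so do the lower indices of
`Γ`. -/
lemma isSymmetric_hess {f : M → ℝ} (hf : ContMDiff I 𝓘(ℝ, ℝ) 2 f) (x : M) :
    (hess I f x : TangentSpace I x →ₗ[ℝ] TangentSpace I x).IsSymmetric := by
  intro u v
  change inner ℝ (hess I f x u) v = inner ℝ u (hess I f x v)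
  rw [real_inner_comm (hess I f x v) u, inner_hess hf, inner_hess hf, chartHess_comm hf.contMDiffAt,
    christoffel_comm]

end Gradient

end RiemannianPullback

namespace RiemannianPullback

/-! ### Second derivative of a function along a curve -/

section Curve

lemma deriv_deriv_comp {E : Type*} [NormedAddCommGroup E] [NormedSpace ℝ E] {g : E → ℝ}
    {γ : ℝ → E} {t : ℝ} (hg : ContDiffAt ℝ 2 g (γ t)) (hγ : ContDiffAt ℝ 2 γ t) :
    deriv (deriv (g ∘ γ)) t =
      fderiv ℝ (fderiv ℝ g) (γ t) (deriv γ t) (deriv γ t) +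
        fderiv ℝ g (γ t) (deriv (deriv γ) t) := by
  have hgd : ∀ᶠ τ in nhds t, DifferentiableAt ℝ g (γ τ) :=
    hγ.continuousAt.eventually ((hg.eventually (by simp)).mono
      fun _ h ↦ h.differentiableAt two_ne_zero)
  have hγd : ∀ᶠ τ in nhds t, DifferentiableAt ℝ γ τ :=
    (hγ.eventually (by simp)).mono fun _ h ↦ h.differentiableAt two_ne_zero
  -- The first-order chain rule must hold on a neighbourhood before it can be differentiated at `t`.
  have h : deriv (g ∘ γ) =ᶠ[nhds t] fun τ ↦ fderiv ℝ g (γ τ) (deriv γ τ) := by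
    filter_upwards [hgd, hγd] with τ h2 h3
    exact fderiv_comp_deriv τ h2 h3
  have h1 : DifferentiableAt ℝ (deriv γ) t :=
    ((hγ.fderiv_right (m := 1) (by norm_num)).differentiableAt one_ne_zero).clm_apply
      (differentiableAt_const (1 : ℝ))
  have h2 : DifferentiableAt ℝ (fderiv ℝ g) (γ t) :=
    (hg.fderiv_right (m := 1) (by norm_num)).differentiableAt one_ne_zero
  rw [h.deriv_eq]
  exact ((h2.hasFDerivAt.comp_hasDerivAt t
    (hγ.differentiableAt two_ne_zero).hasDerivAt).clm_apply h1.hasDerivAt).deriv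

variable {E : Type*} [NormedAddCommGroup E] [NormedSpace ℝ E] [FiniteDimensional ℝ E]
  {H : Type*} [TopologicalSpace H] {I : ModelWithCorners ℝ E H}
  {M : Type*} [TopologicalSpace M] [ChartedSpace H M] [IsManifold I ∞ M]

omit [FiniteDimensional ℝ E] in
lemma hasDerivAt_extChartAt_comp {c : ℝ → M} {x : M} {t : ℝ}
    (hc : MDifferentiableAt 𝓘(ℝ, ℝ) I c t) (hx : c t ∈ (chartAt H x).source) :
    HasDerivAt (extChartAt I x ∘ c) ((trivializationAt E (TangentSpace I) x).continuousLinearMapAt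
      ℝ (c t) (velocity c t)) t := by
  have h := (mdifferentiableAt_extChartAt (I := I) hx).hasMFDerivAt.comp t hc.hasMFDerivAt
  rw [← TangentBundle.continuousLinearMapAt_trivializationAt hx] at h
  let L : ℝ →L[ℝ] E := (trivializationAt E (TangentSpace I) x).continuousLinearMapAt ℝ (c t) ∘L
    mfderiv 𝓘(ℝ, ℝ) I c t
  have h' : HasFDerivAt (extChartAt I x ∘ c) L t := h.hasFDerivAt
  exact h'.hasDerivAt

variable [RiemannianBundle (fun x : M ↦ TangentSpace I x)]
  [IsContMDiffRiemannianBundle I ∞ E (fun x : M ↦ TangentSpace I x)]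

omit [FiniteDimensional ℝ E] [IsManifold I ∞ M]
  [RiemannianBundle (fun x : M ↦ TangentSpace I x)]
  [IsContMDiffRiemannianBundle I ∞ E (fun x : M ↦ TangentSpace I x)] in
lemma eventually_mem_chart_source {c : ℝ → M} (hc : Continuous c) (t : ℝ) :
    ∀ᶠ τ in nhds t, c τ ∈ (chartAt H (c t)).source :=
  hc.continuousAt.eventually (chart_source_mem_nhds H (c t))

/-- Near `t` the components of `c'` are the derivative of the coordinate curve; differentiating them
once more gives the first term. -/
lemma acceleration_eq {c : ℝ → M} (hc : ContMDiff 𝓘(ℝ, ℝ) I 2 c) (t : ℝ) :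
    acceleration c t =
      (trivializationAt E (TangentSpace I) (c t)).symmL ℝ (c t)
        (deriv (deriv (extChartAt I (c t) ∘ c)) t) +
      christoffel (c t) (velocity c t) (velocity c t) := by
  rw [acceleration, covariantDerivAlong, leviCivita_constField]
  congr 2
  refine Filter.EventuallyEq.deriv_eq ?_
  filter_upwards [eventually_mem_chart_source (H := H) hc.continuous t] with τ hτ
  exact (hasDerivAt_extChartAt_comp (hc.mdifferentiable two_ne_zero τ) hτ).deriv.symm

variable [I.Boundaryless]

omit [FiniteDimensional ℝ E] [RiemannianBundle (fun x : M ↦ TangentSpace I x)]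
  [IsContMDiffRiemannianBundle I ∞ E (fun x : M ↦ TangentSpace I x)] in
lemma deriv_deriv_comp_extChartAt {f : M → ℝ} (hf : ContMDiff I 𝓘(ℝ, ℝ) 2 f) {c : ℝ → M}
    (hc : ContMDiff 𝓘(ℝ, ℝ) I 2 c) (t : ℝ) :
    deriv (deriv (f ∘ c)) t =
      chartHess (I := I) f (c t) (deriv (extChartAt I (c t) ∘ c) t)
          (deriv (extChartAt I (c t) ∘ c) t) +
        fderiv ℝ (f ∘ (extChartAt I (c t)).symm) (extChartAt I (c t) (c t))
          (deriv (deriv (extChartAt I (c t) ∘ c)) t) := by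
  have hγ : ContDiffAt ℝ 2 (extChartAt I (c t) ∘ c) t :=
    ((contMDiffAt_extChartAt (I := I) (n := 2) (x := c t)).comp_of_eq
      hc.contMDiffAt rfl).contDiffAt
  have h : f ∘ c =ᶠ[nhds t] (f ∘ (extChartAt I (c t)).symm) ∘ (extChartAt I (c t) ∘ c) := by
    filter_upwards [eventually_mem_chart_source (H := H) hc.continuous t] with τ hτ
    exact congrArg f ((extChartAt I (c t)).left_inv (by rwa [extChartAt_source])).symm
  rw [h.deriv.deriv_eq]
  exact deriv_deriv_comp (contDiffAt_comp_extChartAt_symm (n := 2) hf.contMDiffAt) hγ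

lemma inner_grad_acceleration {f : M → ℝ} (hf : MDifferentiable I 𝓘(ℝ, ℝ) f) {c : ℝ → M}
    (hc : ContMDiff 𝓘(ℝ, ℝ) I 2 c) (t : ℝ) :
    inner ℝ (grad I f (c t)) (acceleration c t) =
      fderiv ℝ (f ∘ (extChartAt I (c t)).symm) (extChartAt I (c t) (c t))
          (deriv (deriv (extChartAt I (c t) ∘ c)) t) +
        inner ℝ (grad I f (c t)) (christoffel (c t) (velocity c t) (velocity c t)) := by
  rw [acceleration_eq hc, inner_add_right]
  congr 1
  exact (inner_grad f (c t) _).trans (mvfderiv_symmL (mem_chart_source H (c t)) (hf (c t)) _)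

lemma deriv_deriv_comp_curve {f : M → ℝ} (hf : ContMDiff I 𝓘(ℝ, ℝ) 2 f) {c : ℝ → M}
    (hc : ContMDiff 𝓘(ℝ, ℝ) I 2 c) (t : ℝ) :
    deriv (deriv (f ∘ c)) t =
      inner ℝ (hess I f (c t) (velocity c t)) (velocity (I := I) c t) +
        inner ℝ (grad I f (c t)) (acceleration c t) := by
  rw [deriv_deriv_comp_extChartAt hf hc, inner_hess hf,
    inner_grad_acceleration (hf.mdifferentiable two_ne_zero) hc,
    (hasDerivAt_extChartAt_comp (hc.mdifferentiable two_ne_zero t)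
      (mem_chart_source H (c t))).deriv]
  -- The term `⟨grad f, Γ(c', c')⟩` enters with opposite signs through the Hessian and the
  -- acceleration.
  ring

end Curve

/-! ### Symmetric operators, and the pullback along a retraction -/

section Pullback

lemma clm_ext_of_isSymmetric {F : Type*} [NormedAddCommGroup F] [InnerProductSpace ℝ F]
    {A B : F →L[ℝ] F} (hA : (A : F →ₗ[ℝ] F).IsSymmetric) (hB : (B : F →ₗ[ℝ] F).IsSymmetric)
    (h : ∀ v, inner ℝ (A v) v = inner ℝ (B v) v) : A = B := by
  have h0 := ((hA.sub hB).inner_map_self_eq_zero).1 fun v ↦ by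
    simpa [inner_sub_left, sub_eq_zero] using h v
  ext v
  simpa [sub_eq_zero] using LinearMap.congr_fun h0 v

/-- Nothing is assumed of `q` beyond `hq`, which makes it the quadratic form of `A - T* S T`;
uniqueness is polarization. -/
lemma exists_isSymmetric_add_conj {F G : Type*} [NormedAddCommGroup F] [InnerProductSpace ℝ F]
    [CompleteSpace F] [NormedAddCommGroup G] [InnerProductSpace ℝ G] [CompleteSpace G]
    {A : F →L[ℝ] F} (hA : (A : F →ₗ[ℝ] F).IsSymmetric)
    {S : G →L[ℝ] G} (hS : (S : G →ₗ[ℝ] G).IsSymmetric) (T : F →L[ℝ] G) {q : F → ℝ}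
    (hq : ∀ v, inner ℝ (A v) v = inner ℝ (S (T v)) (T v) + q v) :
    ∃ W : F →L[ℝ] F, ((W : F →ₗ[ℝ] F).IsSymmetric ∧ ∀ v, inner ℝ (W v) v = q v) ∧
      (∀ W' : F →L[ℝ] F, (W' : F →ₗ[ℝ] F).IsSymmetric →
        (∀ v, inner ℝ (W' v) v = q v) → W' = W) ∧
      A = ContinuousLinearMap.adjoint T ∘L S ∘L T + W := by
  set B := ContinuousLinearMap.adjoint T ∘L S ∘L T with hB
  have hBi (u v : F) : inner ℝ (B u) v = inner ℝ (S (T u)) (T v) := by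
    rw [hB, ContinuousLinearMap.comp_apply, ContinuousLinearMap.adjoint_inner_left,
      ContinuousLinearMap.comp_apply]
  have hBs : (B : F →ₗ[ℝ] F).IsSymmetric := fun u v ↦ by
    change inner ℝ (B u) v = inner ℝ u (B v)
    rw [real_inner_comm (B v) u, hBi, hBi, real_inner_comm (T u)]
    exact hS (T u) (T v)
  have hWs : ((A - B : F →L[ℝ] F) : F →ₗ[ℝ] F).IsSymmetric := hA.sub hBs
  have hWq (v : F) : inner ℝ ((A - B) v) v = q v := by
    rw [sub_apply, inner_sub_left, hBi, hq, add_sub_cancel_left]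
  exact ⟨A - B, ⟨hWs, hWq⟩, fun W hW hWq' ↦
    clm_ext_of_isSymmetric hW hWs fun v ↦ (hWq' v).trans (hWq v).symm, by abel⟩

/-- The Hessian of a `C²` function on a Hilbert space as derivative of its gradient. -/
lemma exists_hasFDerivAt_gradient {F : Type*} [NormedAddCommGroup F] [InnerProductSpace ℝ F]
    [CompleteSpace F] {φ : F → ℝ} (hφ : ContDiff ℝ 2 φ) (s : F) :
    ∃ A : F →L[ℝ] F, HasFDerivAt (gradient φ) A s ∧ (A : F →ₗ[ℝ] F).IsSymmetric ∧
      ∀ v, inner ℝ (A v) v = deriv (deriv fun t : ℝ ↦ φ (s + t • v)) 0 := by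
  -- The Riesz map is typed as conjugate-linear; over `ℝ` it is repackaged as a linear map so that
  -- it can be composed with derivatives.
  let J : (F →L[ℝ] ℝ) →L[ℝ] F :=
    { toFun := (InnerProductSpace.toDual ℝ F).symm
      map_add' := map_add _
      map_smul' := fun a L ↦ by simp
      cont := (InnerProductSpace.toDual ℝ F).symm.continuous }
  have hJ (L : F →L[ℝ] ℝ) (v : F) : inner ℝ (J L) v = L v :=
    InnerProductSpace.toDual_symm_apply (𝕜 := ℝ)
  have hd : Differentiable ℝ (fderiv ℝ φ) :=
    (hφ.fderiv_right (m := 1) (by norm_num)).differentiable one_ne_zero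
  have hline (v : F) (t : ℝ) : HasDerivAt (fun t : ℝ ↦ s + t • v) v t := by
    simpa using ((hasDerivAt_id t).smul_const v).const_add s
  refine ⟨J ∘L fderiv ℝ (fderiv ℝ φ) s, J.hasFDerivAt.comp s (hd s).hasFDerivAt,
    fun u v ↦ ?_, fun v ↦ ?_⟩
  · change inner ℝ (J (fderiv ℝ (fderiv ℝ φ) s u)) v = inner ℝ u (J (fderiv ℝ (fderiv ℝ φ) s v))
    rw [real_inner_comm _ u, hJ, hJ]
    exact (hφ.contDiffAt.isSymmSndFDerivAt (by simp)).eq u v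
  · change inner ℝ (J (fderiv ℝ (fderiv ℝ φ) s v)) v = _
    have hl : deriv (fun t : ℝ ↦ s + t • v) = fun _ ↦ v := funext fun t ↦ (hline v t).deriv
    have h := deriv_deriv_comp (g := φ) (γ := fun t : ℝ ↦ s + t • v) (t := 0) hφ.contDiffAt
      (contDiff_const.add (contDiff_id.smul contDiff_const)).contDiffAt
    -- A line has zero acceleration, so only the Hessian term survives.
    rw [hl, deriv_const, map_zero, add_zero, zero_smul, add_zero] at h
    rw [hJ]
    exact h.symm

lemma mfderiv_comp_line {F : Type*} [NormedAddCommGroup F] [NormedSpace ℝ F]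
    {E : Type*} [NormedAddCommGroup E] [NormedSpace ℝ E]
    {H : Type*} [TopologicalSpace H] {I : ModelWithCorners ℝ E H}
    {M : Type*} [TopologicalSpace M] [ChartedSpace H M] {r : F → M} {s v : F} {t : ℝ}
    (hr : MDifferentiableAt 𝓘(ℝ, F) I r (s + t • v)) :
    mfderiv 𝓘(ℝ, ℝ) I (fun t : ℝ ↦ r (s + t • v)) t (1 : ℝ) =
      mfderiv 𝓘(ℝ, F) I r (s + t • v) v := by
  have hl : HasFDerivAt (fun t : ℝ ↦ s + t • v) (ContinuousLinearMap.toSpanSingleton ℝ v) t := by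
    have h := ((hasDerivAt_id t).smul_const v).const_add s
    rw [one_smul] at h
    exact h.hasFDerivAt
  refine (mfderiv_comp_apply t hr hl.differentiableAt.mdifferentiableAt (1 : ℝ)).trans ?_
  rw [mfderiv_eq_fderiv, hl.fderiv]
  exact congrArg (mfderiv 𝓘(ℝ, F) I r (s + t • v)) (one_smul ℝ v)

variable {E : Type*} [NormedAddCommGroup E] [NormedSpace ℝ E] [FiniteDimensional ℝ E]
  {H : Type*} [TopologicalSpace H] {I : ModelWithCorners ℝ E H}
  {M : Type*} [TopologicalSpace M] [ChartedSpace H M] [IsManifold I ∞ M]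
  [RiemannianBundle (fun x : M ↦ TangentSpace I x)]

omit [FiniteDimensional ℝ E] in
-- The base point is constant and the trivialized fibre component is a continuous linear map.
lemma contMDiff_totalSpaceMk (x : M) :
    ContMDiff 𝓘(ℝ, TangentSpace I x) I.tangent ∞
      (fun s : TangentSpace I x ↦ (⟨x, s⟩ : TangentBundle I M)) := by
  intro s
  refine contMDiffAt_totalSpace.2 ⟨contMDiffAt_const, ?_⟩
  have h : ContMDiffAt 𝓘(ℝ, TangentSpace I x) 𝓘(ℝ, E) ∞
      (fun v ↦ (trivializationAt E (TangentSpace I) x).continuousLinearMapAt ℝ x v) s :=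
    ((trivializationAt E (TangentSpace I) x).continuousLinearMapAt ℝ x).contDiff.contDiffAt.contMDiffAt
  refine h.congr_of_eventuallyEq (.of_forall fun v ↦ ?_)
  exact (Trivialization.continuousLinearMapAt_apply_of_mem (R := ℝ) _
    (FiberBundle.mem_baseSet_trivializationAt' x) v).symm

namespace Retraction

variable (R : Retraction I M)

omit [FiniteDimensional ℝ E] in
lemma contMDiff_restrict (x : M) :
    ContMDiff 𝓘(ℝ, TangentSpace I x) I ∞ (R.restrict x) :=
  R.contMDiff_toFun.comp (contMDiff_totalSpaceMk x)

omit [FiniteDimensional ℝ E] in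
lemma contDiff_pullback {f : M → ℝ} (hf : ContMDiff I 𝓘(ℝ, ℝ) 2 f) (x : M) :
    ContDiff ℝ 2 (R.pullback f x) :=
  (hf.comp ((R.contMDiff_restrict x).of_le (n := ∞) (m := 2) (by norm_cast))).contDiff

omit [FiniteDimensional ℝ E] in
lemma contMDiff_curve (x : M) (s ds : TangentSpace I x) :
    ContMDiff 𝓘(ℝ, ℝ) I ∞ (R.curve x s ds) :=
  (R.contMDiff_restrict x).comp
    (contDiff_const.add (contDiff_id.smul contDiff_const)).contMDiff

omit [FiniteDimensional ℝ E] in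
lemma velocity_curve (x : M) (s ds : TangentSpace I x) (t : ℝ) :
    velocity (I := I) (R.curve x s ds) t = R.diff x (s + t • ds) ds :=
  mfderiv_comp_line ((R.contMDiff_restrict x).mdifferentiable (by simp) (s + t • ds))

variable [IsContMDiffRiemannianBundle I ∞ E (fun x : M ↦ TangentSpace I x)]

omit [IsContMDiffRiemannianBundle I ∞ E (fun x : M ↦ TangentSpace I x)] in
lemma hasGradientAt_pullback {f : M → ℝ} (hf : MDifferentiable I 𝓘(ℝ, ℝ) f) (x : M)
    (s : TangentSpace I x) :
    HasGradientAt (R.pullback f x)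
      (ContinuousLinearMap.adjoint (R.diff x s) (grad I f (R.restrict x s))) s := by
  have hr := (R.contMDiff_restrict x).mdifferentiable (by simp) s
  have h : HasFDerivAt (R.pullback f x) (mvfderiv I f (R.restrict x s) ∘L R.diff x s) s :=
    ((hf (R.restrict x s)).hasMFDerivAt.comp s hr.hasMFDerivAt).hasFDerivAt
  refine hasGradientAt_iff_hasFDerivAt.2 (h.congr_fderiv ?_)
  ext v
  rw [InnerProductSpace.toDual_apply_apply, ContinuousLinearMap.adjoint_inner_left, inner_grad]
  rfl

lemma inner_hess_curve_zero (f : M → ℝ) (x : M) (s ds : TangentSpace I x) :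
    inner ℝ (hess I f (R.curve x s ds 0) (velocity (R.curve x s ds) 0))
        (velocity (I := I) (R.curve x s ds) 0) =
      inner ℝ (hess I f (R.restrict x s) (R.diff x s ds)) (R.diff x s ds) := by
  rw [velocity_curve]
  -- The tangent space depends on the base point, so `s + 0 • ds = s` is substituted in the whole
  -- scalar expression at once.
  exact congrArg (fun s' : TangentSpace I x ↦
    inner ℝ (hess I f (R.restrict x s') (R.diff x s' ds)) (R.diff x s' ds)) (by simp)

lemma deriv_deriv_pullback_line [I.Boundaryless] {f : M → ℝ} (hf : ContMDiff I 𝓘(ℝ, ℝ) 2 f)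
    (x : M) (s ds : TangentSpace I x) :
    deriv (deriv fun t : ℝ ↦ R.pullback f x (s + t • ds)) 0 =
      inner ℝ (hess I f (R.restrict x s) (R.diff x s ds)) (R.diff x s ds) +
        inner ℝ (grad I f (R.curve x s ds 0)) (acceleration (R.curve x s ds) 0) := by
  rw [← inner_hess_curve_zero]
  exact deriv_deriv_comp_curve hf ((R.contMDiff_curve x s ds).of_le (by norm_cast)) 0

end Retraction

end Pullback

end RiemannianPullback

theorem mainTheorem10
    {E : Type*} [NormedAddCommGroup E] [NormedSpace ℝ E] [FiniteDimensional ℝ E]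
    {H : Type*} [TopologicalSpace H] {I : ModelWithCorners ℝ E H} [I.Boundaryless]
    {M : Type*} [TopologicalSpace M] [ChartedSpace H M] [IsManifold I ∞ M]
    [RiemannianBundle (fun x : M ↦ TangentSpace I x)]
    [IsContMDiffRiemannianBundle I ∞ E (fun x : M ↦ TangentSpace I x)]
    (R : RiemannianPullback.Retraction I M) (f : M → ℝ) (hf : ContMDiff I 𝓘(ℝ, ℝ) 2 f) (x : M) :
    (∀ s : TangentSpace I x,
      HasGradientAt (R.pullback f x)
        (ContinuousLinearMap.adjoint (R.diff x s)
          (RiemannianPullback.grad I f (R.restrict x s))) s) ∧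
    ∀ s : TangentSpace I x, ∃ W : TangentSpace I x →L[ℝ] TangentSpace I x,
      ((W : TangentSpace I x →ₗ[ℝ] TangentSpace I x).IsSymmetric ∧
        ∀ ds : TangentSpace I x,
          inner ℝ (W ds) ds =
            inner ℝ (RiemannianPullback.grad I f (R.curve x s ds 0))
              (RiemannianPullback.acceleration (R.curve x s ds) 0)) ∧
      (∀ W' : TangentSpace I x →L[ℝ] TangentSpace I x,
        (W' : TangentSpace I x →ₗ[ℝ] TangentSpace I x).IsSymmetric →
        (∀ ds : TangentSpace I x,
          inner ℝ (W' ds) ds =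
            inner ℝ (RiemannianPullback.grad I f (R.curve x s ds 0))
              (RiemannianPullback.acceleration (R.curve x s ds) 0)) →
        W' = W) ∧
      HasFDerivAt (gradient (R.pullback f x))
        (ContinuousLinearMap.adjoint (R.diff x s) ∘L
          RiemannianPullback.hess I f (R.restrict x s) ∘L R.diff x s + W) s := by
  refine ⟨R.hasGradientAt_pullback (hf.mdifferentiable two_ne_zero) x, fun s ↦ ?_⟩
  obtain ⟨A, hA, hAs, hAq⟩ := RiemannianPullback.exists_hasFDerivAt_gradient
    (R.contDiff_pullback hf x) s
  -- Here `A` is the Hessian of the pullback, `S` is `Hess f`, and `q` is the acceleration term of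
  -- the curve identity at `t = 0`.
  obtain ⟨W, hW, hWu, hAW⟩ := RiemannianPullback.exists_isSymmetric_add_conj hAs
    (RiemannianPullback.isSymmetric_hess hf (R.restrict x s)) (R.diff x s)
    (q := fun ds ↦ inner ℝ (RiemannianPullback.grad I f (R.curve x s ds 0))
      (RiemannianPullback.acceleration (R.curve x s ds) 0)) fun ds ↦
        (hAq ds).trans (R.deriv_deriv_pullback_line hf x s ds)
  exact ⟨W, hW, hWu, hAW ▸ hA⟩
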